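/- Consider $n\ge 1$ periodic tasks $\tau_1,\dots,\tau_n$ on one processor, indexed by decreasing priority, with worst-case execution times $C_i$, periods $T_i$, relative deadlines $D_i$ and phases $\phi_i\ge 0$, where $0<C_i\le D_i\le T_i$ are real; the $m$-th job of $\tau_i$ is released at $\phi_i+(m-1)T_i$ and each of its executions takes a time in $(0,C_i]$. The first $n_c$ tasks are critical. Scheduling is fully non-preemptive with fixed priorities: whenever the processor is free and the system is operational, the released uncompleted job of highest priority is dispatched (earlier jobs of a task first) and runs until it completes. A system-wide restart at time $\rho$ discards the progress of the job in execution; during $C_r\ge 0$ time units nothing executes; then scheduling resumes with the released uncompleted job of highest priority, each such job having to be executed in full. Two restarts are at least $T_r$ apart, and $T_r$ is larger than the least common multiple of the periods of the critical tasks. The task set is RBR-feasible (under this scheduler) if (i) for all restart times allowed above, all jobs of critical tasks complete by their deadlines, and (ii) when there is no restart, all jobs of all tasks complete by their deadlines. For each $i$ let $B_i=\max_{j>i}C_j$ (with $B_n=0$) and $$O_i^{np}=\begin{cases}C_r+\max_{j\le i}C_j & i\le n_c,\\ 0 & i>n_c.\end{cases}$$ Let $L_i$ be the smallest $L>0$ with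 $$L=B_i+\sum_{j\le i}\Big\lceil\frac{L}{T_j}\Big\rceil C_j+O_i^{np},$$ and $K_i=\lceil L_i/T_i\rceil$. For $1\le k\le K_i$ let $S_{i,k}$ be the smallest $S\ge 0$ with $$S=B_i+(k-1)C_i+\sum_{j<i}\Big(\Big\lfloor\frac{S}{T_j}\Big\rfloor+1\Big)C_j+O_i^{np},$$ and let $F_{i,k}=S_{i,k}+C_i$ and $$R_i=\max_{1\le k\le K_i}\{F_{i,k}-(k-1)T_i\}.$$ Theorem. If for every $i$ all these fixed points exist and $R_i\le D_i$, then the task set is RBR-feasible. -/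

import Mathlib

namespace RestartRecovery

/-- A set of `n ≥ 1` periodic tasks on one processor, indexed in order of decreasing priority
(`τ i` has higher priority than `τ j` iff `i < j`), together with the restart parameters.
The critical tasks are the first `nc` ones. -/
structure TaskSystem (n : ℕ) where
  /-- worst-case execution times -/
  C : Fin n → ℝ
  /-- periods -/
  T : Fin n → ℝ
  /-- relative deadlines -/
  D : Fin n → ℝ
  /-- phases (release times of the first jobs) -/
  φ : Fin n → ℝ
  /-- number of critical tasks -/
  nc : ℕ
  /-- time needed to restart the system -/
  Cr : ℝ
  /-- minimum inter-arrival time of faults and consequent restarts -/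
  Tr : ℝ
  n_pos : 0 < n
  nc_le : nc ≤ n
  C_pos : ∀ i, 0 < C i
  C_le_D : ∀ i, C i ≤ D i
  D_le_T : ∀ i, D i ≤ T i
  φ_nonneg : ∀ i, 0 ≤ φ i
  Cr_nonneg : 0 ≤ Cr

/-- The job `(i, m)` is the `(m+1)`-st instance of task `i`. -/
abbrev Job (n : ℕ) := Fin n × ℕ

/-- State of the platform at a scheduling decision. In both cases `done` is the set of jobs that
have been completed so far.
* `up t done`: at time `t` the system is operational and the processor is free.
* `down t done`: a system-wide restart occurs at time `t`. -/
inductive PlatformState (n : ℕ) where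
  | up (t : ℝ) (done : Set (Job n))
  | down (t : ℝ) (done : Set (Job n))

namespace TaskSystem

variable {n : ℕ} (τ : TaskSystem n)

/-! ### Schedules -/

/-- Task `i` belongs to the critical workload. -/
def IsCritical (i : Fin n) : Prop := (i : ℕ) < τ.nc

/-- Release time of a job. -/
def release (J : Job n) : ℝ := τ.φ J.1 + (J.2 : ℝ) * τ.T J.1

/-- Absolute deadline of a job. -/
def deadline (J : Job n) : ℝ := τ.release J + τ.D J.1

/-- The job is released and not completed at time `t`. -/
def Pending (t : ℝ) (done : Set (Job n)) (J : Job n) : Prop :=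
  τ.release J ≤ t ∧ J ∉ done

/-- `J` is the pending job of highest priority; jobs of the same task are served in the order of
their releases. -/
def IsDispatched (t : ℝ) (done : Set (Job n)) (J : Job n) : Prop :=
  τ.Pending t done J ∧
    ∀ J', τ.Pending t done J' → J.1 < J'.1 ∨ (J.1 = J'.1 ∧ J.2 ≤ J'.2)

/-- `r` is the earliest release time after `t`. -/
def IsNextRelease (t r : ℝ) : Prop :=
  IsLeast {x : ℝ | t < x ∧ ∃ J : Job n, x = τ.release J} r

/-- `ρ` is the earliest restart after `t`, and it is not later than `u`. -/
def FirstRestart (Rs : Set ℝ) (t u ρ : ℝ) : Prop :=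
  IsLeast {x : ℝ | x ∈ Rs ∧ t < x} ρ ∧ ρ ≤ u

/-- No restart occurs in `(t, u]`. -/
def NoRestart (Rs : Set ℝ) (t u : ℝ) : Prop :=
  ∀ ρ ∈ Rs, ¬ (t < ρ ∧ ρ ≤ u)

/-- One step of the fully non-preemptive fixed-priority scheduler with restart-based recovery.
`Rs` is the set of restart times and `e J` the time that `J` needs if it is dispatched now. -/
inductive Step (Rs : Set ℝ) (e : Job n → ℝ) : PlatformState n → PlatformState n → Prop
  /-- The highest-priority pending job is executed without preemption until it completes. -/
  | finish {t : ℝ} {done : Set (Job n)} {J : Job n} :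
      τ.IsDispatched t done J → NoRestart Rs t (t + e J) →
      Step Rs e (.up t done) (.up (t + e J) (insert J done))
  /-- The highest-priority pending job is executed, and hit by a restart before it has completed
  (a job whose execution ends at the very instant of a restart does not count as completed). -/
  | interrupt {t ρ : ℝ} {done : Set (Job n)} {J : Job n} :
      τ.IsDispatched t done J → FirstRestart Rs t (t + e J) ρ →
      Step Rs e (.up t done) (.down ρ done)
  /-- No job is pending: the processor idles until the next release. -/
  | idle {t r : ℝ} {done : Set (Job n)} :
      (∀ J, ¬ τ.Pending t done J) → τ.IsNextRelease t r → NoRestart Rs t r →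
      Step Rs e (.up t done) (.up r done)
  /-- No job is pending, and a restart occurs while the processor idles. -/
  | idleRestart {t r ρ : ℝ} {done : Set (Job n)} :
      (∀ J, ¬ τ.Pending t done J) → τ.IsNextRelease t r → FirstRestart Rs t r ρ →
      Step Rs e (.up t done) (.down ρ done)
  /-- After `Cr` time units the system is operational again. All the progress of uncompleted jobs
  is lost; they are pending as before, with their original priorities. -/
  | reboot {t : ℝ} {done : Set (Job n)} :
      NoRestart Rs t (t + τ.Cr) →
      Step Rs e (.down t done) (.up (t + τ.Cr) done)
  /-- A restart occurs while the system is still rebooting. -/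
  | rebootAgain {t ρ : ℝ} {done : Set (Job n)} :
      FirstRestart Rs t (t + τ.Cr) ρ →
      Step Rs e (.down t done) (.down ρ done)

/-- Actual execution times: `e s J` is the time that job `J` needs if it is dispatched at step `s`
of the schedule (so that a re-execution may take a different time). It is at most the worst-case
execution time. -/
def ValidExec (e : ℕ → Job n → ℝ) : Prop :=
  ∀ s J, 0 < e s J ∧ e s J ≤ τ.C J.1

/-- Restart times allowed by the fault model: consecutive restarts are at least `Tr` apart. -/
def ValidRestarts (Rs : Set ℝ) : Prop :=
  (∀ ρ ∈ Rs, 0 ≤ ρ) ∧ ∀ ρ ∈ Rs, ∀ ρ' ∈ Rs, ρ < ρ' → τ.Tr ≤ ρ' - ρ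

open Classical in
/-- The platform starts at time `0`. -/
noncomputable def initialState (Rs : Set ℝ) : PlatformState n :=
  if (0 : ℝ) ∈ Rs then .down 0 ∅ else .up 0 ∅

/-- A schedule produced by the non-preemptive fixed-priority scheduler. -/
def IsSchedule (Rs : Set ℝ) (e : ℕ → Job n → ℝ) (σ : ℕ → PlatformState n) : Prop :=
  σ 0 = initialState Rs ∧ ∀ s, τ.Step Rs (e s) (σ s) (σ (s + 1))

/-- In the schedule `σ` the job `J` is completed not later than its deadline. -/
def MeetsDeadline (σ : ℕ → PlatformState n) (J : Job n) : Prop :=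
  ∃ s t done, σ s = .up t done ∧ J ∈ done ∧ t ≤ τ.deadline J

/-- For the given restart and execution times, the scheduler produces a schedule, and every
schedule that it can produce lets all jobs of the tasks satisfying `P` meet their deadlines. -/
def Schedulable (Rs : Set ℝ) (e : ℕ → Job n → ℝ) (P : Fin n → Prop) : Prop :=
  (∃ σ, τ.IsSchedule Rs e σ) ∧
    ∀ σ, τ.IsSchedule Rs e σ → ∀ J : Job n, P J.1 → τ.MeetsDeadline σ J

/-- Feasibility under restart-based recovery, for fully non-preemptive fixed-priority scheduling.
(i) All jobs of critical tasks, or their re-executions, meet their deadlines in spite of restarts;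
(ii) all jobs of all tasks meet their deadlines when no restart is performed. -/
def RBRFeasible : Prop :=
  (∀ Rs, τ.ValidRestarts Rs → ∀ e, τ.ValidExec e → τ.Schedulable Rs e τ.IsCritical) ∧
    ∀ e, τ.ValidExec e → τ.Schedulable ∅ e (fun _ => True)

/-- `Tr` exceeds the hyper-period of the critical tasks: some positive common multiple of their
periods (equivalently, the least one) is smaller than `Tr`. -/
def HyperperiodLtTr : Prop :=
  ∃ H : ℝ, 0 < H ∧ (∀ i, τ.IsCritical i → ∃ m : ℕ, H = m * τ.T i) ∧ H < τ.Tr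

/-! ### Response-time analysis -/

open Classical in
/-- Blocking `B i`: the largest WCET among the tasks of lower priority (`0` if there are none). -/
noncomputable def blocking (i : Fin n) : ℝ :=
  if h : (Finset.Ioi i).Nonempty then (Finset.Ioi i).sup' h τ.C else 0

open Classical in
/-- Restart overhead `O i`: `Cr` plus the largest WCET among task `i` and the tasks of higher
priority if `i` is critical, and `0` otherwise. -/
noncomputable def overhead (i : Fin n) : ℝ :=
  if τ.IsCritical i then τ.Cr + (Finset.Iic i).sup' ⟨i, Finset.mem_Iic.2 le_rfl⟩ τ.C else 0

/-- `L` is the length of the longest level-`i` active period: the smallest positive fixed point of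
the workload with priority at least that of `i`, plus blocking and overhead. -/
def IsActivePeriod (i : Fin n) (L : ℝ) : Prop :=
  IsLeast {x : ℝ | 0 < x ∧
    x = τ.blocking i + ∑ j ∈ Finset.Iic i, (⌈x / τ.T j⌉ : ℝ) * τ.C j + τ.overhead i} L

/-- `S` is the start time of the `k`-th job of task `i` in the level-`i` active period, `k ≥ 1`. -/
def IsStartTime (i : Fin n) (k : ℕ) (S : ℝ) : Prop :=
  IsLeast {x : ℝ | 0 ≤ x ∧
    x = τ.blocking i + ((k : ℝ) - 1) * τ.C i
      + ∑ j ∈ Finset.Iio i, ((⌊x / τ.T j⌋ : ℝ) + 1) * τ.C j + τ.overhead i} S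

/-- `R` is the response time of task `i`: all the fixed points in question exist, and `R` is the
maximum of `F k - (k - 1) * T i` over `1 ≤ k ≤ ⌈L / T i⌉`, where `F k = S k + C i`. -/
def IsResponseTime (i : Fin n) (R : ℝ) : Prop :=
  ∃ (L : ℝ) (S : ℕ → ℝ), τ.IsActivePeriod i L ∧
    (∀ k ∈ Finset.Icc 1 ⌈L / τ.T i⌉₊, τ.IsStartTime i k (S k)) ∧
    IsGreatest {x : ℝ | ∃ k ∈ Finset.Icc 1 ⌈L / τ.T i⌉₊,
      x = (S k + τ.C i) - ((k : ℝ) - 1) * τ.T i} R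

end TaskSystem

end RestartRecovery

namespace RestartRecovery

namespace TaskSystem

variable {n : ℕ} (τ : TaskSystem n)

/-! ### Elementary facts about the parameters -/

/-! Fix a job of task `i` and take the last scheduling decision, not after its release, at which no
job of priority at least that of `i` released strictly earlier is unfinished. From then until the
job completes there is always such a backlog, so the processor never idles, and a job of lower
priority can run only in the first step, at a cost of at most the blocking. If at most one restart
hits this busy period, it costs `Cr` plus the discarded execution, hence at most the overhead. All
other elapsed time is work of jobs completed meanwhile. Comparison with the fixed points shows that
the busy period is shorter than `L` (`IsBusyStart.exists_account`), so the job is the `k`-th one for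
some `k` covered by the analysis, and that it starts within `S k` (`IsSchedule.meetsDeadline`).

There remains the bound on the number of restarts. Restarts are known only to be further apart than
the hyper-period `H`, so `L ≤ H` is needed for critical tasks (`IsActivePeriod.le_hyperperiod`).
Suppose `H < L`, and consider all tasks with phase zero. By the response bound, the last job of `i`
released before `H` completes by `H`. Its execution is admissible blocking for the tasks of higher
priority, and their own response bounds, applied by recursion on priority (`exists_last_start`,
`remaining_work_le`), make all their work released from its start until `H` fit before `H` as well.
Thus the workload at `H` is at most `H`, which forces `L ≤ H` because `L` is the least positive
fixed point. -/

lemma T_pos (i : Fin n) : 0 < τ.T i :=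
  lt_of_lt_of_le (τ.C_pos i) ((τ.C_le_D i).trans (τ.D_le_T i))

lemma C_le_blocking {i j : Fin n} (h : i < j) : τ.C j ≤ τ.blocking i := by
  have hj : j ∈ Finset.Ioi i := Finset.mem_Ioi.2 h
  rw [blocking, dif_pos ⟨j, hj⟩]
  exact Finset.le_sup' τ.C hj

lemma blocking_nonneg (i : Fin n) : 0 ≤ τ.blocking i := by
  by_cases h : (Finset.Ioi i).Nonempty
  · obtain ⟨j, hj⟩ := h
    exact (τ.C_pos j).le.trans (τ.C_le_blocking (Finset.mem_Ioi.1 hj))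
  · rw [blocking, dif_neg h]

lemma add_C_le_overhead {i j : Fin n} (hi : τ.IsCritical i) (h : j ≤ i) :
    τ.Cr + τ.C j ≤ τ.overhead i := by
  rw [overhead, if_pos hi]
  have := Finset.le_sup' τ.C (Finset.mem_Iic.2 h)
  linarith

lemma overhead_nonneg (i : Fin n) : 0 ≤ τ.overhead i := by
  by_cases h : τ.IsCritical i
  · have := τ.add_C_le_overhead h le_rfl
    have := τ.C_pos i
    have := τ.Cr_nonneg
    linarith
  · rw [overhead, if_neg h]

lemma sum_Iic_eq (i : Fin n) (f : Fin n → ℝ) :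
    ∑ j ∈ Finset.Iic i, f j = ∑ j ∈ Finset.Iio i, f j + f i := by
  rw [← Finset.Iio_insert, Finset.sum_insert (by simp), add_comm]

/-- All fixed points of the analysis of task `i` exist, and the resulting completion times respect
the deadlines. -/
def ResponseBounded (i : Fin n) : Prop :=
  ∃ (L : ℝ) (S : ℕ → ℝ), τ.IsActivePeriod i L ∧
    ∀ k ∈ Finset.Icc 1 ⌈L / τ.T i⌉₊, τ.IsStartTime i k (S k) ∧
      S k + τ.C i ≤ ((k : ℝ) - 1) * τ.T i + τ.D i

lemma IsResponseTime.responseBounded {τ : TaskSystem n} {i : Fin n} {R : ℝ}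
    (h : τ.IsResponseTime i R) (hR : R ≤ τ.D i) : τ.ResponseBounded i := by
  obtain ⟨L, S, hL, hS, hmax⟩ := h
  refine ⟨L, S, hL, fun k hk => ⟨hS k hk, ?_⟩⟩
  have := hmax.2 ⟨k, hk, rfl⟩
  linarith

/-! ### The active period of a critical task fits into the hyper-period -/

/-- If all jobs of tasks `j ≤ p` with index below `e j` have been served at time `s`, up to a
blocking `c`, then the last job of `p` before the hyper-period `H` can start at a time `s'` which
leaves room for its execution before `H`; `e'` collects the jobs of higher priority released until
`s'`. -/
lemma exists_last_start {p : Fin n} (hb : τ.ResponseBounded p) {H s c : ℝ} {M : ℤ}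
    (hM : H = M * τ.T p) {e : Fin n → ℤ} (hc : c ≤ τ.blocking p)
    (he : ∀ j ≤ p, s ≤ e j * τ.T j) (hep : e p ≤ M - 1) :
    ∃ (s' : ℝ) (e' : Fin n → ℤ), s' + τ.C p ≤ H ∧ (∀ j < p, s' ≤ e' j * τ.T j) ∧
      c + ∑ j ∈ Finset.Iio p, ((e' j : ℝ) - e j) * τ.C j + ((M : ℝ) - 1 - e p) * τ.C p
        ≤ s' - s := by
  obtain ⟨L, S, hL, hS⟩ := hb
  obtain ⟨hL0, hLeq⟩ := hL.1
  have hTp := τ.T_pos p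
  -- Time advances from `s` in windows of length `L` until the last release of `p` before `H` lies
  -- less than `L` ahead. The point reached is `a`, and the jobs with index below `f j` are already
  -- counted. The work counted may exceed the elapsed time by the blocking of `p`, and `N` bounds
  -- the number of windows left.
  have key : ∀ N : ℕ, ∀ (a : ℝ) (f : Fin n → ℤ), ((M : ℝ) - 1) * τ.T p - a ≤ N * L →
      (∀ j ≤ p, a ≤ f j * τ.T j) → f p ≤ M - 1 →
      c + ∑ j ∈ Finset.Iic p, ((f j : ℝ) - e j) * τ.C j ≤ a - s + τ.blocking p →
      ∃ (s' : ℝ) (e' : Fin n → ℤ), s' + τ.C p ≤ H ∧ (∀ j < p, s' ≤ e' j * τ.T j) ∧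
        c + ∑ j ∈ Finset.Iio p, ((e' j : ℝ) - e j) * τ.C j + ((M : ℝ) - 1 - e p) * τ.C p
          ≤ s' - s := by
    intro N
    induction N with
    | zero => ?_
    | succ N ih => ?_
    all_goals
      intro a f hN hf hfp hw
      by_cases hcase : a + L ≤ ((M : ℝ) - 1) * τ.T p
    · exfalso
      simp only [Nat.cast_zero, zero_mul] at hN
      linarith
    rotate_left
    · refine ih (a + L) (fun j => ⌈(a + L) / τ.T j⌉) ?_ ?_ ?_ ?_
      · push_cast at hN
        linarith
      · intro j _
        rw [← div_le_iff₀ (τ.T_pos j)]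
        exact Int.le_ceil _
      · rw [Int.ceil_le, div_le_iff₀ hTp]
        push_cast
        exact hcase
      -- Subadditivity of the ceiling: a window adds at most the sum in the equation for `L`, so the
      -- invariant survives.
      · have hsum : ∑ j ∈ Finset.Iic p, ((⌈(a + L) / τ.T j⌉ : ℝ) - e j) * τ.C j ≤
            ∑ j ∈ Finset.Iic p, ((f j : ℝ) - e j) * τ.C j +
              ∑ j ∈ Finset.Iic p, (⌈L / τ.T j⌉ : ℝ) * τ.C j := by
          rw [← Finset.sum_add_distrib]
          refine Finset.sum_le_sum fun j hj => ?_
          have hle : ⌈(a + L) / τ.T j⌉ ≤ f j + ⌈L / τ.T j⌉ := by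
            rw [Int.ceil_le]
            push_cast
            rw [add_div]
            exact add_le_add ((div_le_iff₀ (τ.T_pos j)).2 (hf j (Finset.mem_Iic.1 hj)))
              (Int.le_ceil _)
          have hle' : (⌈(a + L) / τ.T j⌉ : ℝ) ≤ f j + ⌈L / τ.T j⌉ := by exact_mod_cast hle
          rw [← add_mul]
          exact mul_le_mul_of_nonneg_right (by linarith) (τ.C_pos j).le
        have := τ.overhead_nonneg p
        have := τ.blocking_nonneg p
        linarith
    -- Both remaining cases have the last release `(M - 1) * T p` before `a + L`. Its job is number
    -- `k = M - f p` among the jobs of `p` not yet counted, and `k` is within the range of the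
    -- analysis. The blocking contained in `S k` absorbs the slack of the invariant.
    all_goals
      obtain ⟨k, hk⟩ : ∃ k : ℕ, (k : ℤ) = M - f p := ⟨(M - f p).toNat, by omega⟩
      have hkR : (k : ℝ) = M - f p := by exact_mod_cast hk
      have hk1 : 1 ≤ k := by omega
      have hfpa := hf p le_rfl
      have hkL : ((k : ℝ) - 1) * τ.T p < L := by
        rw [hkR]
        nlinarith
      have hkK : k ∈ Finset.Icc 1 ⌈L / τ.T p⌉₊ := by
        rw [Finset.mem_Icc]
        refine ⟨hk1, ?_⟩
        have h1 : (k : ℝ) - 1 < L / τ.T p := by rwa [lt_div_iff₀ hTp]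
        have h2 : (k : ℝ) < ⌈L / τ.T p⌉₊ + 1 := by
          have := Nat.le_ceil (L / τ.T p)
          linarith
        have h3 : k < ⌈L / τ.T p⌉₊ + 1 := by exact_mod_cast h2
        omega
      obtain ⟨⟨⟨hS0, hSeq⟩, -⟩, hSd⟩ := hS k hkK
      refine ⟨a + S k, fun j => ⌊(a + S k) / τ.T j⌋ + 1, ?_, ?_, ?_⟩
      · have := τ.D_le_T p
        rw [hkR] at hSd
        rw [hM]
        nlinarith
      · intro j _
        rw [← div_le_iff₀ (τ.T_pos j)]
        push_cast
        exact (Int.lt_floor_add_one _).le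
      · have hsum : ∑ j ∈ Finset.Iio p, (((⌊(a + S k) / τ.T j⌋ + 1 : ℤ) : ℝ) - e j) * τ.C j ≤
            ∑ j ∈ Finset.Iio p, ((f j : ℝ) - e j) * τ.C j +
              ∑ j ∈ Finset.Iio p, ((⌊S k / τ.T j⌋ : ℝ) + 1) * τ.C j := by
          rw [← Finset.sum_add_distrib]
          refine Finset.sum_le_sum fun j hj => ?_
          have hle : ⌊(a + S k) / τ.T j⌋ ≤ f j + ⌊S k / τ.T j⌋ := by
            rw [← Int.floor_intCast_add]
            refine Int.floor_le_floor ?_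
            rw [add_div]
            exact add_le_add ((div_le_iff₀ (τ.T_pos j)).2
              (hf j (Finset.mem_Iio.1 hj).le)) le_rfl
          have hle' : (⌊(a + S k) / τ.T j⌋ : ℝ) ≤ f j + ⌊S k / τ.T j⌋ := by exact_mod_cast hle
          rw [← add_mul]
          refine mul_le_mul_of_nonneg_right ?_ (τ.C_pos j).le
          push_cast
          linarith
        rw [sum_Iic_eq] at hw
        have := τ.overhead_nonneg p
        have hk' : ((M : ℝ) - 1 - e p) * τ.C p =
            ((f p : ℝ) - e p) * τ.C p + ((k : ℝ) - 1) * τ.C p := by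
          rw [hkR]
          ring
        linarith
  obtain ⟨N, hN⟩ := exists_nat_ge ((((M : ℝ) - 1) * τ.T p - s) / L)
  refine key N s e ?_ he hep ?_
  · rwa [div_le_iff₀ hL0] at hN
  · simpa using hc

/-- The work of priority above `m` released from the jobs `e j` on, together with a blocking `c` at
time `s`, is served before the hyper-period `H`. -/
lemma remaining_work_le {H : ℝ} {M : Fin n → ℤ} (m : ℕ) (hmn : m ≤ n)
    (hM : ∀ j : Fin n, (j : ℕ) < m → H = M j * τ.T j)
    (hb : ∀ j : Fin n, (j : ℕ) < m → τ.ResponseBounded j) {s c : ℝ} {e : Fin n → ℤ}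
    (hs : s + c ≤ H) (hc : ∀ j : Fin n, (j : ℕ) < m → c ≤ τ.blocking j)
    (he : ∀ j : Fin n, (j : ℕ) < m → s ≤ e j * τ.T j) :
    c + ∑ j ∈ Finset.univ.filter fun j : Fin n => (j : ℕ) < m, ((M j : ℝ) - e j) * τ.C j ≤ H - s := by
  induction m generalizing s c e with
  | zero =>
    simp
    linarith
  | succ m ih =>
    have ih' := fun {s c : ℝ} {e : Fin n → ℤ} => @ih (by omega)
      (fun j hj => hM j (by omega)) (fun j hj => hb j (by omega)) s c e
    obtain ⟨p, hp⟩ : ∃ p : Fin n, (p : ℕ) = m := ⟨⟨m, hmn⟩, rfl⟩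
    have h1 : (Finset.univ.filter fun j : Fin n => (j : ℕ) < m) = Finset.Iio p := by
      ext j
      simp [Fin.lt_def, hp]
    have h2 : (Finset.univ.filter fun j : Fin n => (j : ℕ) < m + 1) = Finset.Iic p := by
      ext j
      simp [Fin.le_def, hp]
    rw [h2, sum_Iic_eq]
    rw [h1] at ih'
    -- If `p` has jobs left, move to the start of its last one, whose execution becomes the blocking
    -- `C p` in the induction hypothesis. Otherwise the term of `p` is nonpositive and can be
    -- dropped.
    by_cases hep : e p ≤ M p - 1
    · obtain ⟨s', e', hs', he', hsum⟩ := τ.exists_last_start (hb p (by omega))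
        (hM p (by omega)) (hc p (by omega))
        (fun j hj => he j (by rw [Fin.le_def] at hj; omega)) hep
      have := ih' hs'
        (fun j hj => τ.C_le_blocking (by rw [Fin.lt_def]; omega))
        (fun j hj => he' j (by rw [Fin.lt_def]; omega))
      have hsplit : ∑ j ∈ Finset.Iio p, ((M j : ℝ) - e j) * τ.C j =
          ∑ j ∈ Finset.Iio p, ((M j : ℝ) - e' j) * τ.C j +
            ∑ j ∈ Finset.Iio p, ((e' j : ℝ) - e j) * τ.C j := by
        rw [← Finset.sum_add_distrib]
        exact Finset.sum_congr rfl fun j _ => by ring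
      rw [hsplit]
      linarith
    · have := ih' hs (fun j hj => hc j (by omega)) (fun j hj => he j (by omega))
      have hle : (M p : ℝ) ≤ e p := by exact_mod_cast (by omega : M p ≤ e p)
      have : ((M p : ℝ) - e p) * τ.C p ≤ 0 :=
        mul_nonpos_of_nonpos_of_nonneg (by linarith) (τ.C_pos p).le
      linarith

/-- A positive point where the workload does not exceed the elapsed time bounds the active
period. -/
lemma IsActivePeriod.le_of_workload_le {τ : TaskSystem n} {i : Fin n} {L : ℝ}
    (hL : τ.IsActivePeriod i L) {x : ℝ} (hx : 0 < x)
    (h : τ.blocking i + ∑ j ∈ Finset.Iic i, (⌈x / τ.T j⌉ : ℝ) * τ.C j + τ.overhead i ≤ x) :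
    L ≤ x := by
  set W : ℝ → ℝ := fun y =>
    τ.blocking i + ∑ j ∈ Finset.Iic i, (⌈y / τ.T j⌉ : ℝ) * τ.C j + τ.overhead i with hW
  have hmono : Monotone W := by
    intro y z hyz
    simp only [hW]
    gcongr with j hj
    · exact (τ.C_pos j).le
    · exact (τ.T_pos j).le
  have hlow : ∀ y, 0 < y → τ.C i ≤ W y := by
    intro y hy
    have h1 : τ.C i ≤ (⌈y / τ.T i⌉ : ℝ) * τ.C i := by
      have : (1 : ℝ) ≤ ⌈y / τ.T i⌉ := by
        exact_mod_cast Int.one_le_ceil_iff.2 (div_pos hy (τ.T_pos i))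
      nlinarith [τ.C_pos i]
    have h2 : (⌈y / τ.T i⌉ : ℝ) * τ.C i ≤ ∑ j ∈ Finset.Iic i, (⌈y / τ.T j⌉ : ℝ) * τ.C j := by
      refine Finset.single_le_sum (f := fun j => (⌈y / τ.T j⌉ : ℝ) * τ.C j) (fun j _ => ?_)
        (Finset.mem_Iic.2 le_rfl)
      have : (0 : ℝ) ≤ ⌈y / τ.T j⌉ := by
        exact_mod_cast Int.ceil_nonneg (div_pos hy (τ.T_pos j)).le
      exact mul_nonneg this (τ.C_pos j).le
    have := τ.blocking_nonneg i
    have := τ.overhead_nonneg i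
    simp only [hW]
    linarith
  -- As in Knaster–Tarski, the infimum of the points with `W y ≤ y` is a fixed point of the monotone
  -- `W`. The lower bound `C i` keeps it positive.
  set A : Set ℝ := {y | 0 < y ∧ W y ≤ y} with hA
  have hxA : x ∈ A := ⟨hx, h⟩
  have hbdd : ∀ y ∈ A, τ.C i ≤ y := fun y hy => (hlow y hy.1).trans hy.2
  have hBdd : BddBelow A := ⟨τ.C i, hbdd⟩
  have hm0 : 0 < sInf A := (τ.C_pos i).trans_le (le_csInf ⟨x, hxA⟩ hbdd)
  have hm1 : W (sInf A) ≤ sInf A :=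
    le_csInf ⟨x, hxA⟩ fun y hy => (hmono (csInf_le hBdd hy)).trans hy.2
  have hm2 : sInf A ≤ W (sInf A) :=
    csInf_le hBdd ⟨(τ.C_pos i).trans_le (hlow _ hm0), hmono hm1⟩
  exact (hL.2 ⟨hm0, le_antisymm hm2 hm1⟩).trans (csInf_le hBdd hxA)

/-- The active period of a critical task is not longer than the hyper-period. -/
lemma IsActivePeriod.le_hyperperiod {τ : TaskSystem n} (hb : ∀ j, τ.ResponseBounded j)
    {i : Fin n} {L H : ℝ} (hL : τ.IsActivePeriod i L) (hH : 0 < H)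
    (hHm : ∀ j ≤ i, ∃ m : ℕ, H = m * τ.T j) : L ≤ H := by
  -- The assumption `H < L` is what brings the last job before `H`, number `k = H / T i`, into the
  -- range where its response bound is available.
  by_contra! hlt
  obtain ⟨L', S, hL', hS⟩ := hb i
  obtain rfl : L = L' := hL.unique hL'
  have hHm' : ∀ j, ∃ m : ℤ, j ≤ i → H = m * τ.T j := by
    intro j
    by_cases hj : j ≤ i
    · obtain ⟨m, hm⟩ := hHm j hj
      exact ⟨m, fun _ => by simpa using hm⟩
    · exact ⟨0, fun h => absurd h hj⟩
  choose M hM using hHm'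
  obtain ⟨k, hk⟩ := hHm i le_rfl
  have hTi := τ.T_pos i
  have hMk : (M i : ℝ) = k := by
    have := (hM i le_rfl).symm.trans hk
    exact mul_right_cancel₀ hTi.ne' this
  have hk1 : 1 ≤ k := by
    rcases Nat.eq_zero_or_pos k with rfl | h
    · simp at hk
      linarith
    · exact h
  have hkK : k ∈ Finset.Icc 1 ⌈L / τ.T i⌉₊ := by
    rw [Finset.mem_Icc]
    refine ⟨hk1, ?_⟩
    have h1 : (k : ℝ) ≤ L / τ.T i := by
      rw [le_div_iff₀ hTi]
      linarith
    exact_mod_cast h1.trans (Nat.le_ceil _)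
  obtain ⟨⟨⟨hS0, hSeq⟩, -⟩, hSd⟩ := hS k hkK
  have hD := τ.D_le_T i
  have hrem := τ.remaining_work_le (H := H) (M := M) (i : ℕ) i.2.le
    (fun j hj => hM j (Fin.le_def.2 hj.le)) (fun j _ => hb j)
    (s := S k) (c := τ.C i) (e := fun j => ⌊S k / τ.T j⌋ + 1) (by nlinarith)
    (fun j hj => τ.C_le_blocking (Fin.lt_def.2 hj))
    (fun j _ => by
      rw [← div_le_iff₀ (τ.T_pos j)]
      push_cast
      exact (Int.lt_floor_add_one _).le)
  have hfil : (Finset.univ.filter fun j : Fin n => (j : ℕ) < i) = Finset.Iio i := by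
    ext j
    simp
  rw [hfil] at hrem
  refine absurd (hL.le_of_workload_le hH ?_) (not_le.2 hlt)
  have hceil : ∀ j ≤ i, (⌈H / τ.T j⌉ : ℝ) = M j := by
    intro j hj
    rw [hM j hj, mul_div_cancel_right₀ _ (τ.T_pos j).ne', Int.ceil_intCast]
  rw [sum_Iic_eq, hceil i le_rfl, hMk,
    Finset.sum_congr rfl fun j hj => by rw [hceil j (Finset.mem_Iio.1 hj).le]]
  -- Jobs of higher priority up to `H` are split at `S k`: the earlier ones are paid for by the
  -- equation for `S k`, the later ones by `hrem`.
  have hsplit : ∑ j ∈ Finset.Iio i, (M j : ℝ) * τ.C j =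
      ∑ j ∈ Finset.Iio i, ((M j : ℝ) - ((⌊S k / τ.T j⌋ + 1 : ℤ) : ℝ)) * τ.C j +
        ∑ j ∈ Finset.Iio i, ((⌊S k / τ.T j⌋ : ℝ) + 1) * τ.C j := by
    rw [← Finset.sum_add_distrib]
    exact Finset.sum_congr rfl fun j _ => by push_cast; ring
  rw [hsplit]
  linarith

end TaskSystem

end RestartRecovery

namespace RestartRecovery

namespace PlatformState

variable {n : ℕ}

/-- The time of a state. -/
def time : PlatformState n → ℝ
  | up t _ => t
  | down t _ => t

/-- The set of completed jobs in a state. -/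
def completed : PlatformState n → Set (Job n)
  | up _ d => d
  | down _ d => d

/-- `1` if the system is operational, `0` during a restart. -/
def upCount : PlatformState n → ℕ
  | up _ _ => 1
  | down _ _ => 0

end PlatformState

namespace TaskSystem

variable {n : ℕ} (τ : TaskSystem n)

/-! ### Existence of schedules -/

lemma release_lt_release (i : Fin n) {l m : ℕ} (h : l < m) :
    τ.release (i, l) < τ.release (i, m) := by
  have : (l : ℝ) < m := by exact_mod_cast h
  have := mul_lt_mul_of_pos_right this (τ.T_pos i)
  simp only [release]
  linarith

lemma finite_release_le (X : ℝ) : {J : Job n | τ.release J ≤ X}.Finite := by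
  have hsub : {J : Job n | τ.release J ≤ X} ⊆
      ⋃ i : Fin n, (fun m : ℕ => (i, m)) '' {m : ℕ | m ≤ ⌊X / τ.T i⌋₊} := by
    rintro ⟨i, m⟩ hJ
    refine Set.mem_iUnion.2 ⟨i, m, ?_, rfl⟩
    refine Nat.le_floor ?_
    rw [le_div_iff₀ (τ.T_pos i)]
    have h1 : τ.φ i + (m : ℝ) * τ.T i ≤ X := hJ
    have := τ.φ_nonneg i
    linarith
  exact (Set.finite_iUnion fun i => (Set.finite_le_nat _).image _).subset hsub

lemma exists_isNextRelease (t : ℝ) : ∃ r, τ.IsNextRelease t r := by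
  obtain ⟨m, hm⟩ := exists_nat_gt (t / τ.T ⟨0, τ.n_pos⟩)
  have hJ0 : t < τ.release (⟨0, τ.n_pos⟩, m) := by
    rw [div_lt_iff₀ (τ.T_pos _)] at hm
    have := τ.φ_nonneg ⟨0, τ.n_pos⟩
    simp only [release]
    linarith
  set X := τ.release (⟨0, τ.n_pos⟩, m)
  have hfin : {J : Job n | τ.release J ≤ X ∧ t < τ.release J}.Finite :=
    (τ.finite_release_le X).subset fun J h => h.1
  obtain ⟨J, hJ, hmin⟩ := Set.exists_min_image _ τ.release hfin
    ⟨(⟨0, τ.n_pos⟩, m), le_rfl, hJ0⟩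
  refine ⟨τ.release J, ⟨hJ.2, J, rfl⟩, ?_⟩
  rintro x ⟨hx, J', rfl⟩
  rcases le_total (τ.release J') X with h | h
  · exact hmin J' ⟨h, hx⟩
  · exact hJ.1.trans h

lemma exists_isDispatched {t : ℝ} {d : Set (Job n)} {J₀ : Job n} (h : τ.Pending t d J₀) :
    ∃ J, τ.IsDispatched t d J := by
  obtain ⟨J, hJ, hmin⟩ := Set.exists_min_image {J : Job n | τ.Pending t d J}
    (fun J => toLex J) ((τ.finite_release_le t).subset fun J h => h.1) ⟨J₀, h⟩
  refine ⟨J, hJ, fun J' hJ' => ?_⟩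
  have := hmin J' hJ'
  rwa [Prod.Lex.toLex_le_toLex] at this

/-- A restart within `Tr` of the infimum of the later restarts has no other one between, so the
infimum is attained. -/
lemma noRestart_or_firstRestart {Rs : Set ℝ} (hTr : 0 < τ.Tr) (hRs : τ.ValidRestarts Rs)
    (t u : ℝ) : NoRestart Rs t u ∨ ∃ ρ, FirstRestart Rs t u ρ := by
  by_cases h : NoRestart Rs t u
  · exact Or.inl h
  right
  simp only [NoRestart, not_forall, not_not] at h
  obtain ⟨ρ₀, hρ₀, htρ, hρu⟩ := h
  set A : Set ℝ := {x | x ∈ Rs ∧ t < x}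
  have hne : A.Nonempty := ⟨ρ₀, hρ₀, htρ⟩
  have hbdd : BddBelow A := ⟨t, fun x hx => hx.2.le⟩
  obtain ⟨ρ, hρ, hlt⟩ := exists_lt_of_csInf_lt hne (lt_add_of_pos_right (sInf A) hTr)
  have hleast : IsLeast A ρ := by
    refine ⟨hρ, fun y hy => ?_⟩
    by_contra! hyρ
    have h1 := hRs.2 y hy.1 ρ hρ.1 hyρ
    have h2 := csInf_le hbdd hy
    linarith
  exact ⟨ρ, hleast, (hleast.2 ⟨hρ₀, htρ⟩).trans hρu⟩

lemma exists_step {Rs : Set ℝ} (hTr : 0 < τ.Tr) (hRs : τ.ValidRestarts Rs) (e : Job n → ℝ)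
    (x : PlatformState n) : ∃ y, τ.Step Rs e x y := by
  cases x with
  | up t d =>
    by_cases h : ∃ J, τ.Pending t d J
    · obtain ⟨J₀, h⟩ := h
      obtain ⟨J, hJ⟩ := τ.exists_isDispatched h
      rcases τ.noRestart_or_firstRestart hTr hRs t (t + e J) with hr | ⟨ρ, hr⟩
      · exact ⟨_, .finish hJ hr⟩
      · exact ⟨_, .interrupt hJ hr⟩
    · push Not at h
      obtain ⟨r, hnext⟩ := τ.exists_isNextRelease t
      rcases τ.noRestart_or_firstRestart hTr hRs t r with hr | ⟨ρ, hr⟩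
      · exact ⟨_, .idle h hnext hr⟩
      · exact ⟨_, .idleRestart h hnext hr⟩
  | down t d =>
    rcases τ.noRestart_or_firstRestart hTr hRs t (t + τ.Cr) with hr | ⟨ρ, hr⟩
    · exact ⟨_, .reboot hr⟩
    · exact ⟨_, .rebootAgain hr⟩

lemma exists_isSchedule {Rs : Set ℝ} (hTr : 0 < τ.Tr) (hRs : τ.ValidRestarts Rs)
    (e : ℕ → Job n → ℝ) : ∃ σ, τ.IsSchedule Rs e σ := by
  choose f hf using fun s x => τ.exists_step hTr hRs (e s) x
  exact ⟨fun s => Nat.rec (initialState Rs) f s, rfl, fun s => hf s _⟩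

/-! ### Basic properties of schedules -/

section Schedule

variable {τ} {Rs : Set ℝ} {e : ℕ → Job n → ℝ} {σ : ℕ → PlatformState n}

lemma Step.time_le {e : Job n → ℝ} (he : ∀ J, 0 < e J) {x y : PlatformState n}
    (h : τ.Step Rs e x y) : x.time ≤ y.time := by
  cases h with
  | @finish t d J hJ hr => exact le_add_of_nonneg_right (he J).le
  | interrupt hJ hr => exact hr.1.1.2.le
  | idle hp hn hr => exact hn.1.1.le
  | idleRestart hp hn hr => exact hr.1.1.2.le
  | reboot hr => exact le_add_of_nonneg_right τ.Cr_nonneg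
  | rebootAgain hr => exact hr.1.1.2.le

lemma Step.completed_subset {e : Job n → ℝ} {x y : PlatformState n}
    (h : τ.Step Rs e x y) : x.completed ⊆ y.completed := by
  cases h with
  | finish hJ hr => exact Set.subset_insert _ _
  | _ => exact subset_rfl

lemma IsSchedule.time_mono (hσ : τ.IsSchedule Rs e σ) (he : τ.ValidExec e) :
    Monotone fun s => (σ s).time :=
  monotone_nat_of_le_succ fun s => (hσ.2 s).time_le fun J => (he s J).1

lemma IsSchedule.completed_mono (hσ : τ.IsSchedule Rs e σ) :
    Monotone fun s => (σ s).completed :=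
  monotone_nat_of_le_succ fun s => (hσ.2 s).completed_subset

lemma initialState_time : (initialState Rs : PlatformState n).time = 0 := by
  unfold initialState
  split_ifs <;> rfl

lemma initialState_completed : (initialState Rs : PlatformState n).completed = ∅ := by
  unfold initialState
  split_ifs <;> rfl

/-- Strictness comes from positive execution times. It ensures that a job is not yet completed at
the start of its busy period, even if that is its release time. -/
lemma IsSchedule.release_lt_time (hσ : τ.IsSchedule Rs e σ) (he : τ.ValidExec e) (s : ℕ)
    {J : Job n} (hJ : J ∈ (σ s).completed) : τ.release J < (σ s).time := by
  induction s with
  | zero => simp [hσ.1, initialState_completed] at hJ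
  | succ s ih =>
    have hstep := hσ.2 s
    have hle := hstep.time_le fun J => (he s J).1
    by_cases hJs : J ∈ (σ s).completed
    · exact (ih hJs).trans_le hle
    generalize σ s = x at *
    generalize σ (s + 1) = y at *
    cases hstep with
    | @finish t d J' hJ' hr =>
      rcases hJ with rfl | hJ
      · have h1 := hJ'.1.1
        have h2 := (he s J).1
        simp only [PlatformState.time]
        linarith
      · exact absurd hJ hJs
    | _ => exact absurd hJ hJs

lemma IsSchedule.time_mem_of_down (hσ : τ.IsSchedule Rs e σ) {s : ℕ} {t : ℝ} {d : Set (Job n)}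
    (h : σ s = .down t d) : t ∈ Rs := by
  cases s with
  | zero =>
    rw [hσ.1] at h
    unfold initialState at h
    split_ifs at h with h0
    cases h
    exact h0
  | succ s =>
    have hstep := hσ.2 s
    rw [h] at hstep
    generalize σ s = x at *
    cases hstep with
    | interrupt hJ hr => exact hr.1.1.1
    | idleRestart hp hn hr => exact hr.1.1.1
    | rebootAgain hr => exact hr.1.1.1

/-- The separation puts distinct restarts into distinct cells of length `Tr`. -/
lemma ValidRestarts.finite_le (hTr : 0 < τ.Tr) (hRs : τ.ValidRestarts Rs) (X : ℝ) :
    {ρ | ρ ∈ Rs ∧ ρ ≤ X}.Finite := by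
  refine Set.Finite.of_injOn (f := fun ρ => ⌊ρ / τ.Tr⌋₊) (t := {m : ℕ | m ≤ ⌊X / τ.Tr⌋₊}) ?_ ?_
    (Set.finite_le_nat _)
  · intro ρ hρ
    exact Nat.floor_le_floor (by gcongr; exact hρ.2)
  · have key : ∀ ρ ∈ Rs, ∀ ρ' ∈ Rs, ρ < ρ' → ⌊ρ / τ.Tr⌋₊ ≠ ⌊ρ' / τ.Tr⌋₊ := by
      intro ρ hρ ρ' hρ' hlt heq
      have h1 := hRs.2 ρ hρ ρ' hρ' hlt
      have h2 : ρ / τ.Tr + 1 ≤ ρ' / τ.Tr := by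
        rw [div_add_one hTr.ne']
        gcongr
        linarith
      have h3 := Nat.floor_le_floor h2
      rw [Nat.floor_add_one (div_nonneg (hRs.1 ρ hρ) hTr.le)] at h3
      omega
    intro ρ hρ ρ' hρ' heq
    rcases lt_trichotomy ρ ρ' with h | h | h
    · exact absurd heq (key ρ hρ.1 ρ' hρ'.1 h)
    · exact h
    · exact absurd heq.symm (key ρ' hρ'.1 ρ hρ.1 h)

/-- Only finitely many steps take place before any given time. -/
lemma IsSchedule.exists_time_gt (hσ : τ.IsSchedule Rs e σ) (he : τ.ValidExec e)
    (hTr : 0 < τ.Tr) (hRs : τ.ValidRestarts Rs) (X : ℝ) : ∃ s, X < (σ s).time := by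
  by_contra! hX
  set F := {J : Job n | τ.release J ≤ X}
  set Q := {ρ | ρ ∈ Rs ∧ ρ ≤ X}
  have hF : F.Finite := τ.finite_release_le X
  have hQ : Q.Finite := hRs.finite_le hTr X
  set a : ℕ → ℕ := fun s => (F ∩ (σ s).completed).ncard with ha
  set b : ℕ → ℕ := fun s => (F ∩ {J | τ.release J ≤ (σ s).time}).ncard with hb
  set c : ℕ → ℕ := fun s => (Q ∩ {ρ | ρ ≤ (σ s).time}).ncard with hc
  -- Step durations have no positive lower bound, so events are counted: completions, releases and
  -- restarts up to `X`. Each step raises one of these counts, except a completed reboot, which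
  -- raises only `upCount`; the factor 2 pays for the loss of `upCount` at a restart.
  set μ : ℕ → ℕ := fun s => 2 * (a s + b s + c s) + (σ s).upCount with hμ
  have hup : ∀ s, (σ s).upCount ≤ 1 := by
    intro s
    cases σ s <;> simp [PlatformState.upCount]
  have hbound : ∀ s, μ s ≤ 2 * (F.ncard + F.ncard + Q.ncard) + 1 := by
    intro s
    have h1 : a s ≤ F.ncard := Set.ncard_le_ncard Set.inter_subset_left hF
    have h2 : b s ≤ F.ncard := Set.ncard_le_ncard Set.inter_subset_left hF
    have h3 : c s ≤ Q.ncard := Set.ncard_le_ncard Set.inter_subset_left hQ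
    have := hup s
    simp only [hμ]
    omega
  have hlt : ∀ s, μ s < μ (s + 1) := by
    intro s
    have hstep := hσ.2 s
    have hle := hstep.time_le fun J => (he s J).1
    have ha' : a s ≤ a (s + 1) := Set.ncard_le_ncard
      (Set.inter_subset_inter_right _ hstep.completed_subset) (hF.inter_of_left _)
    have hb' : b s ≤ b (s + 1) := Set.ncard_le_ncard
      (Set.inter_subset_inter_right _ fun J hJ => le_trans hJ hle) (hF.inter_of_left _)
    have hc' : c s ≤ c (s + 1) := Set.ncard_le_ncard
      (Set.inter_subset_inter_right _ fun J hJ => le_trans hJ hle) (hQ.inter_of_left _)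
    have hX' := hX (s + 1)
    have hX0 := hX s
    have ha'' : ∀ J ∈ (σ (s + 1)).completed, J ∉ (σ s).completed → τ.release J ≤ X →
        a s < a (s + 1) := fun J h1 h2 h3 => Set.ncard_lt_ncard
      ⟨Set.inter_subset_inter_right _ hstep.completed_subset, fun h => h2 (h ⟨h3, h1⟩).2⟩
      (hF.inter_of_left _)
    have hb'' : ∀ J, τ.release J ≤ (σ (s + 1)).time → (σ s).time < τ.release J →
        b s < b (s + 1) := fun J h1 h2 => Set.ncard_lt_ncard
      ⟨Set.inter_subset_inter_right _ fun J hJ => le_trans hJ hle,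
        fun h => not_le.2 h2 (h ⟨h1.trans hX', h1⟩).2⟩ (hF.inter_of_left _)
    have hc'' : ∀ ρ ∈ Rs, ρ ≤ (σ (s + 1)).time → (σ s).time < ρ →
        c s < c (s + 1) := fun ρ h0 h1 h2 => Set.ncard_lt_ncard
      ⟨Set.inter_subset_inter_right _ fun J hJ => le_trans hJ hle,
        fun h => not_le.2 h2 (h ⟨⟨h0, h1.trans hX'⟩, h1⟩).2⟩ (hQ.inter_of_left _)
    have hu1 := hup s
    simp only [hμ]
    clear_value a b c
    clear hbound ha hb hc hμ
    generalize σ s = x at *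
    generalize σ (s + 1) = y at *
    cases hstep with
    | @finish t d J hJ hr =>
      have := ha'' J (Set.mem_insert _ _) hJ.1.2 (hJ.1.1.trans hX0)
      simp only [PlatformState.upCount]
      omega
    | interrupt hJ hr =>
      have := hc'' _ hr.1.1.1 le_rfl hr.1.1.2
      simp only [PlatformState.upCount]
      omega
    | idle hp hn hr =>
      obtain ⟨h1, J, rfl⟩ := hn.1
      have := hb'' J le_rfl h1
      simp only [PlatformState.upCount]
      omega
    | idleRestart hp hn hr =>
      have := hc'' _ hr.1.1.1 le_rfl hr.1.1.2
      simp only [PlatformState.upCount]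
      omega
    | reboot hr =>
      simp only [PlatformState.upCount]
      omega
    | rebootAgain hr =>
      have := hc'' _ hr.1.1.1 le_rfl hr.1.1.2
      simp only [PlatformState.upCount]
      omega
  have hmono : ∀ s, s ≤ μ s := fun s => (strictMono_nat_of_lt_succ hlt).le_apply
  have h1 := hbound (2 * (F.ncard + F.ncard + Q.ncard) + 2)
  have h2 := hmono (2 * (F.ncard + F.ncard + Q.ncard) + 2)
  omega

end Schedule

end TaskSystem

end RestartRecovery

namespace RestartRecovery

namespace TaskSystem

variable {n : ℕ} {τ : TaskSystem n}

/-! ### Workload of a finite set of jobs -/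

lemma sum_C_le {G : Finset (Job n)} {A : Finset (Fin n)} {N : Fin n → ℝ}
    (hG : ∀ J ∈ G, J.1 ∈ A) (hN : ∀ j ∈ A, ((G.filter fun J => J.1 = j).card : ℝ) ≤ N j) :
    ∑ J ∈ G, τ.C J.1 ≤ ∑ j ∈ A, N j * τ.C j := by
  rw [← Finset.sum_fiberwise_of_maps_to hG]
  refine Finset.sum_le_sum fun j hj => ?_
  rw [Finset.sum_congr rfl fun J hJ => by rw [(Finset.mem_filter.1 hJ).2], Finset.sum_const,
    nsmul_eq_mul]
  exact mul_le_mul_of_nonneg_right (hN j hj) (τ.C_pos j).le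

/-- Jobs of one task are determined by their index. Nonnegativity of `N` covers an empty range with
`hi < lo`. -/
lemma card_filter_task_le {G : Finset (Job n)} {j : Fin n} {lo hi N : ℤ}
    (h : ∀ J ∈ G, J.1 = j → lo ≤ (J.2 : ℤ) ∧ (J.2 : ℤ) < hi) (hN : hi - lo ≤ N) (h0 : 0 ≤ N) :
    ((G.filter fun J => J.1 = j).card : ℝ) ≤ N := by
  have hcard : (G.filter fun J => J.1 = j).card ≤ (Finset.Ico lo hi).card := by
    refine Finset.card_le_card_of_injOn (fun J => (J.2 : ℤ)) ?_ ?_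
    · intro J hJ
      have hJ' := Finset.mem_filter.1 (Finset.mem_coe.1 hJ)
      exact Finset.mem_coe.2 (Finset.mem_Ico.2 (h J hJ'.1 hJ'.2))
    · intro J hJ J' hJ' heq
      have h1 := (Finset.mem_filter.1 (Finset.mem_coe.1 hJ)).2
      have h2 := (Finset.mem_filter.1 (Finset.mem_coe.1 hJ')).2
      exact Prod.ext (h1.trans h2.symm) (by simpa using heq)
  rw [Int.card_Ico] at hcard
  have : ((G.filter fun J => J.1 = j).card : ℤ) ≤ N := by omega
  exact_mod_cast this

lemma ceil_le_index {J : Job n} {a : ℝ} (h : a ≤ τ.release J) :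
    ⌈(a - τ.φ J.1) / τ.T J.1⌉ ≤ (J.2 : ℤ) := by
  rw [Int.ceil_le, div_le_iff₀ (τ.T_pos _)]
  simp only [release] at h
  push_cast
  linarith

/-- Jobs released in a half-open interval of length `x`. -/
lemma card_filter_task_le_ceil {G : Finset (Job n)} {j : Fin n} {a x : ℝ} (hx : 0 ≤ x)
    (h : ∀ J ∈ G, J.1 = j → a ≤ τ.release J ∧ τ.release J < a + x) :
    ((G.filter fun J => J.1 = j).card : ℝ) ≤ ⌈x / τ.T j⌉ := by
  refine card_filter_task_le (lo := ⌈(a - τ.φ j) / τ.T j⌉)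
    (hi := ⌈(a - τ.φ j) / τ.T j + x / τ.T j⌉) ?_ ?_ (Int.ceil_nonneg (div_nonneg hx (τ.T_pos j).le))
  · rintro J hJ rfl
    obtain ⟨h1, h2⟩ := h J hJ rfl
    refine ⟨ceil_le_index h1, ?_⟩
    rw [Int.lt_ceil, ← add_div, lt_div_iff₀ (τ.T_pos _)]
    simp only [release] at h2
    push_cast
    linarith
  · have := Int.ceil_add_le ((a - τ.φ j) / τ.T j) (x / τ.T j)
    omega

/-- Jobs released in a closed interval of length `x`. -/
lemma card_filter_task_le_floor {G : Finset (Job n)} {j : Fin n} {a x : ℝ} (hx : 0 ≤ x)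
    (h : ∀ J ∈ G, J.1 = j → a ≤ τ.release J ∧ τ.release J ≤ a + x) :
    ((G.filter fun J => J.1 = j).card : ℝ) ≤ (⌊x / τ.T j⌋ : ℝ) + 1 := by
  have key : ((G.filter fun J => J.1 = j).card : ℝ) ≤ ((⌊x / τ.T j⌋ + 1 : ℤ) : ℝ) := by
    refine card_filter_task_le (lo := ⌈(a - τ.φ j) / τ.T j⌉)
      (hi := ⌊(a - τ.φ j) / τ.T j + x / τ.T j⌋ + 1) ?_ ?_ ?_
    · rintro J hJ rfl
      obtain ⟨h1, h2⟩ := h J hJ rfl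
      refine ⟨ceil_le_index h1, ?_⟩
      rw [Int.lt_add_one_iff, Int.le_floor, ← add_div, le_div_iff₀ (τ.T_pos _)]
      simp only [release] at h2
      push_cast
      linarith
    · have h1 : ⌊(a - τ.φ j) / τ.T j + x / τ.T j⌋ ≤
          ⌈(a - τ.φ j) / τ.T j⌉ + ⌊x / τ.T j⌋ := by
        rw [← Int.floor_intCast_add]
        exact Int.floor_le_floor (by gcongr; exact Int.le_ceil _)
      omega
    · have := Int.floor_nonneg.2 (div_nonneg hx (τ.T_pos j).le)
      omega
  exact_mod_cast key

/-- The work of priority at least that of `i` released in an active period. -/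
lemma IsActivePeriod.sum_C_le {i : Fin n} {L a : ℝ} (hL : τ.IsActivePeriod i L)
    {G : Finset (Job n)}
    (hG : ∀ J ∈ G, J.1 ≤ i ∧ a ≤ τ.release J ∧ τ.release J < a + L) :
    τ.blocking i + τ.overhead i + ∑ J ∈ G, τ.C J.1 ≤ L := by
  have h := τ.sum_C_le (G := G) (A := Finset.Iic i) (N := fun j => (⌈L / τ.T j⌉ : ℝ))
    (fun J hJ => Finset.mem_Iic.2 (hG J hJ).1)
    (fun j _ => card_filter_task_le_ceil hL.1.1.le fun J hJ _ => (hG J hJ).2)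
  have := hL.1.2
  linarith

/-! ### Busy periods -/

section Busy

variable {Rs : Set ℝ} {e : ℕ → Job n → ℝ} {σ : ℕ → PlatformState n}

/-- `p` starts a busy period for the job `J`: at step `p` there is no backlog of priority at least
that of `J`, and from then on there is one until `J` is completed. -/
def IsBusyStart (τ : TaskSystem n) (σ : ℕ → PlatformState n) (J : Job n) (p : ℕ) : Prop :=
  (∀ J' : Job n, J'.1 ≤ J.1 → τ.release J' < (σ p).time → J' ∈ (σ p).completed) ∧
    (σ p).time ≤ τ.release J ∧ J ∉ (σ p).completed ∧
    ∀ q, p < q → J ∉ (σ q).completed →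
      ∃ J' : Job n, J'.1 ≤ J.1 ∧ τ.release J' < (σ q).time ∧ J' ∉ (σ q).completed

lemma IsSchedule.exists_isBusyStart (hσ : τ.IsSchedule Rs e σ) (he : τ.ValidExec e)
    (hTr : 0 < τ.Tr) (hRs : τ.ValidRestarts Rs) (J : Job n) : ∃ p, τ.IsBusyStart σ J p := by
  classical
  obtain ⟨N, hN⟩ := hσ.exists_time_gt he hTr hRs (τ.release J)
  have hmono := hσ.time_mono he
  -- The busy period starts at the last such step. Later steps either violate `P` through a backlog,
  -- or come after the release of `J`, where `J` itself is the backlog.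
  let P : ℕ → Prop := fun q =>
    (∀ J' : Job n, J'.1 ≤ J.1 → τ.release J' < (σ q).time → J' ∈ (σ q).completed) ∧
      (σ q).time ≤ τ.release J
  have hrel : ∀ J' : Job n, 0 ≤ τ.release J' := fun J' =>
    add_nonneg (τ.φ_nonneg _) (mul_nonneg (Nat.cast_nonneg _) (τ.T_pos _).le)
  have hP0 : P 0 := by
    simp only [P, hσ.1, initialState_time]
    exact ⟨fun J' _ h => absurd h (not_lt.2 (hrel J')), hrel J⟩
  have hPp : P (Nat.findGreatest P N) := Nat.findGreatest_spec (Nat.zero_le N) hP0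
  refine ⟨Nat.findGreatest P N, hPp.1, hPp.2,
    fun h => absurd (hσ.release_lt_time he _ h) (not_lt.2 hPp.2), fun q hq hJq => ?_⟩
  by_cases hqr : (σ q).time ≤ τ.release J
  · have hqN : q ≤ N := by
      by_contra! hlt
      have : (σ N).time ≤ (σ q).time := hmono hlt.le
      linarith
    have hnP := Nat.findGreatest_is_greatest hq hqN
    simp only [P, not_and] at hnP
    by_contra! hcon
    exact hnP hcon hqr
  · exact ⟨J, le_rfl, not_le.1 hqr, hJq⟩

/-- Accounting of the time elapsed in a busy period of `J` started at step `p`, when step `q` is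
reached: `G` is the set of the jobs completed meanwhile, and `w` the time lost by a restart. -/
structure Account (τ : TaskSystem n) (Rs : Set ℝ) (σ : ℕ → PlatformState n) (J : Job n) (p q : ℕ)
    (G : Finset (Job n)) (w : ℝ) : Prop where
  task_le : ∀ J' ∈ G, J'.1 ≤ J.1
  le_release : ∀ J' ∈ G, (σ p).time ≤ τ.release J'
  release_le : ∀ J' ∈ G, ∃ q' < q, τ.release J' ≤ (σ q').time
  mem_completed : ∀ J' ∈ G, J' ∈ (σ q).completed
  index_lt : ∀ J' ∈ G, J'.1 = J.1 → J'.2 < J.2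
  time_le : (σ q).time - (σ p).time ≤
    (if q = p then 0 else τ.blocking J.1) + w + ∑ J' ∈ G, τ.C J'.1
  mode : (∃ t d, σ q = .up t d ∧
      (w = 0 ∨ w = τ.overhead J.1 ∧ ∃ ρ ∈ Rs, (σ p).time ≤ ρ ∧ ρ ≤ t)) ∨
    ∃ t d, σ q = .down t d ∧ τ.Cr + w = τ.overhead J.1

/-- The hypothesis `hcrit` treats both feasibility clauses at once: either the task is critical, or
there are no restarts. -/
lemma Account.nonneg_and_le {J : Job n} {p q : ℕ} {G : Finset (Job n)} {w : ℝ}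
    (h : τ.Account Rs σ J p q G w) (hσ : τ.IsSchedule Rs e σ)
    (hcrit : ∀ ρ ∈ Rs, τ.IsCritical J.1) : 0 ≤ w ∧ w ≤ τ.overhead J.1 := by
  have h0 := τ.overhead_nonneg J.1
  rcases h.mode with ⟨t, d, -, rfl | ⟨rfl, -⟩⟩ | ⟨t, d, hd, hw⟩
  · exact ⟨le_rfl, h0⟩
  · exact ⟨h0, le_rfl⟩
  · have := τ.add_C_le_overhead (hcrit t (hσ.time_mem_of_down hd)) le_rfl
    have := τ.C_pos J.1
    have := τ.Cr_nonneg
    constructor <;> linarith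

lemma Account.time_le' {J : Job n} {p q : ℕ} {G : Finset (Job n)} {w : ℝ}
    (h : τ.Account Rs σ J p q G w) (hσ : τ.IsSchedule Rs e σ)
    (hcrit : ∀ ρ ∈ Rs, τ.IsCritical J.1) :
    (σ q).time - (σ p).time ≤ τ.blocking J.1 + τ.overhead J.1 + ∑ J' ∈ G, τ.C J'.1 := by
  have h1 := h.time_le
  have h2 := (h.nonneg_and_le hσ hcrit).2
  have h3 := τ.blocking_nonneg J.1
  split_ifs at h1 <;> linarith

/-- As long as there is a backlog, the time elapsed is shorter than the active period. -/
lemma Account.time_lt {J : Job n} {p q : ℕ} {G : Finset (Job n)} {w L : ℝ}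
    (h : τ.Account Rs σ J p (q + 1) G w) (hσ : τ.IsSchedule Rs e σ) (he : τ.ValidExec e)
    (hcrit : ∀ ρ ∈ Rs, τ.IsCritical J.1) (hL : τ.IsActivePeriod J.1 L)
    (hp : τ.IsBusyStart σ J p) (hpq : p ≤ q) (hq : (σ q).time < (σ p).time + L)
    (hJ : J ∉ (σ (q + 1)).completed) : (σ (q + 1)).time < (σ p).time + L := by
  classical
  have hGL : ∀ J' ∈ G, J'.1 ≤ J.1 ∧ (σ p).time ≤ τ.release J' ∧
      τ.release J' < (σ p).time + L := by
    intro J' hJ'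
    obtain ⟨q', hq', hrel⟩ := h.release_le J' hJ'
    have : (σ q').time ≤ (σ q).time := hσ.time_mono he (Nat.lt_succ_iff.1 hq')
    exact ⟨h.task_le J' hJ', h.le_release J' hJ', by linarith⟩
  have hle := hL.sum_C_le hGL
  have ht := h.time_le' hσ hcrit
  obtain ⟨J₁, hJ₁, hrel, hnot⟩ := hp.2.2.2 (q + 1) (by omega) hJ
  have ha : (σ p).time ≤ τ.release J₁ := by
    by_contra! hlt
    exact hnot (hσ.completed_mono (by omega : p ≤ q + 1) (hp.1 J₁ hJ₁ hlt))
  -- The backlog job `J₁` is also released within `L` but not in `G`, so its positive execution time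
  -- makes the bound strict.
  have hins := hL.sum_C_le (G := insert J₁ G) (a := (σ p).time) (by
    intro J' hJ'
    rcases Finset.mem_insert.1 hJ' with rfl | hJ'
    · exact ⟨hJ₁, ha, by linarith⟩
    · exact hGL J' hJ')
  rw [Finset.sum_insert fun hmem => hnot (h.mem_completed J₁ hmem)] at hins
  have := τ.C_pos J₁.1
  linarith

/-- One step of a busy period. -/
lemma Account.exists_succ {J : Job n} {p q : ℕ} {G : Finset (Job n)} {w L : ℝ}
    (h : τ.Account Rs σ J p q G w) (hσ : τ.IsSchedule Rs e σ) (he : τ.ValidExec e)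
    (hcrit : ∀ ρ ∈ Rs, τ.IsCritical J.1)
    (hsep : ∀ ρ ∈ Rs, ∀ ρ' ∈ Rs, ρ < ρ' → L < ρ' - ρ) (hL : τ.IsActivePeriod J.1 L)
    (hp : τ.IsBusyStart σ J p) (hpq : p ≤ q) (hq : (σ q).time < (σ p).time + L)
    (hJ : J ∉ (σ (q + 1)).completed) : ∃ G' w', τ.Account Rs σ J p (q + 1) G' w' := by
  classical
  have hstep := hσ.2 q
  have hmono := hσ.time_mono he
  have hsub := hstep.completed_subset
  have hJq : J ∉ (σ q).completed := fun h => hJ (hsub h)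
  have hne : q + 1 ≠ p := by omega
  have hpq' : (σ p).time ≤ (σ q).time := hmono hpq
  have hqq' : (σ q).time ≤ (σ (q + 1)).time := hmono (Nat.le_succ q)
  have hB := τ.blocking_nonneg J.1
  have hO := τ.overhead_nonneg J.1
  obtain ⟨hw0, hwO⟩ := h.nonneg_and_le hσ hcrit
  have hG0 : 0 ≤ ∑ J' ∈ G, τ.C J'.1 := Finset.sum_nonneg fun J' _ => (τ.C_pos J'.1).le
  have hif : (if q = p then 0 else τ.blocking J.1) ≤ τ.blocking J.1 := by
    split_ifs <;> linarith
  have htime := h.time_le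
  have hrelG : ∀ J' ∈ G, ∃ q' < q + 1, τ.release J' ≤ (σ q').time := fun J' hJ' => by
    obtain ⟨q', h1, h2⟩ := h.release_le J' hJ'
    exact ⟨q', by omega, h2⟩
  -- the account with the same set of jobs
  have keep : ∀ w', (σ (q + 1)).time - (σ p).time ≤ τ.blocking J.1 + w' + ∑ J' ∈ G, τ.C J'.1 →
      ((∃ t d, σ (q + 1) = .up t d ∧
        (w' = 0 ∨ w' = τ.overhead J.1 ∧ ∃ ρ ∈ Rs, (σ p).time ≤ ρ ∧ ρ ≤ t)) ∨
      ∃ t d, σ (q + 1) = .down t d ∧ τ.Cr + w' = τ.overhead J.1) →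
      τ.Account Rs σ J p (q + 1) G w' := fun w' h1 h2 =>
    ⟨h.task_le, h.le_release, hrelG, fun J' hJ' => hsub (h.mem_completed J' hJ'), h.index_lt,
      by rwa [if_neg hne], h2⟩
  -- a job of lower priority can be dispatched in the first step only
  have hlow : ∀ t d J', σ q = .up t d → τ.IsDispatched t d J' → J.1 < J'.1 → q = p := by
    intro t d J' hup hJ' hlt
    by_contra hqp
    obtain ⟨J₁, h1, h2, h3⟩ := hp.2.2.2 q (by omega) hJq
    rw [hup] at h2 h3
    have h4 := hJ'.2 J₁ ⟨h2.le, h3⟩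
    have h5 : J'.1 ≤ J₁.1 := by
      rcases h4 with h4 | h4
      · exact h4.le
      · exact h4.1.le
    exact absurd (h5.trans h1) (not_le.2 hlt)
  -- a dispatched job of high priority has been released in the busy period
  have hhigh : ∀ t d J', σ q = .up t d → τ.IsDispatched t d J' → J'.1 ≤ J.1 →
      (σ p).time ≤ τ.release J' := by
    intro t d J' hup hJ' hle
    by_contra! hlt
    have h1 := hσ.completed_mono hpq (hp.1 J' hle hlt)
    simp only [hup] at h1
    exact hJ'.1.2 h1
  -- the elapsed time never exceeds the active period, even if the current job is counted
  have hbound : ∀ t d J', σ q = .up t d → τ.IsDispatched t d J' →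
      t + τ.C J'.1 ≤ (σ p).time + L := by
    intro t d J' hup hJ'
    have htq : (σ q).time = t := by rw [hup]; rfl
    rcases le_or_gt J'.1 J.1 with hle | hlt
    · have hnG : J' ∉ G := fun hmem => by
        have := h.mem_completed J' hmem
        rw [hup] at this
        exact hJ'.1.2 this
      have hins := hL.sum_C_le (G := insert J' G) (a := (σ p).time) (by
        intro J₁ hJ₁
        rcases Finset.mem_insert.1 hJ₁ with rfl | hJ₁
        · exact ⟨hle, hhigh t d _ hup hJ' hle, by linarith [hJ'.1.1]⟩
        · obtain ⟨q', h1, h2⟩ := h.release_le J₁ hJ₁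
          have : (σ q').time ≤ (σ q).time := hmono h1.le
          exact ⟨h.task_le J₁ hJ₁, h.le_release J₁ hJ₁, by linarith⟩)
      rw [Finset.sum_insert hnG] at hins
      linarith
    · have hqp := hlow t d J' hup hJ' hlt
      have h1 := τ.C_le_blocking hlt
      have h2 := hL.sum_C_le (G := ∅) (a := 0) (by simp)
      rw [Finset.sum_empty] at h2
      rw [hqp] at htq
      linarith
  -- no idling
  have hidle : ∀ t d r, σ q = .up t d → (∀ J', ¬ τ.Pending t d J') → τ.IsNextRelease t r →
      (σ (q + 1)).completed = d → r < (σ (q + 1)).time := by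
    intro t d r hup hnp hr hd
    obtain ⟨J₁, h1, h2, h3⟩ := hp.2.2.2 (q + 1) (by omega) hJ
    rw [hd] at h3
    have h4 : t < τ.release J₁ := by
      by_contra! hle
      exact hnp J₁ ⟨hle, h3⟩
    exact (hr.2 ⟨h4, J₁, rfl⟩).trans_lt h2
  have hmode := h.mode
  have hdown := @IsSchedule.time_mem_of_down n τ Rs e σ hσ q
  generalize hx : σ q = x at *
  generalize hy : σ (q + 1) = y at *
  cases hstep with
  | @finish t d J' hJ' hr =>
    have hCe := (he q J').2
    have hnJ : J' ≠ J := by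
      rintro rfl
      exact hJ (Set.mem_insert _ _)
    have hup : w = 0 ∨ w = τ.overhead J.1 ∧ ∃ ρ ∈ Rs, (σ p).time ≤ ρ ∧ ρ ≤ t := by
      rcases hmode with ⟨t', d', h1, h2⟩ | ⟨t', d', h1, h2⟩
      · cases h1
        exact h2
      · cases h1
    have hup' : w = 0 ∨ w = τ.overhead J.1 ∧ ∃ ρ ∈ Rs, (σ p).time ≤ ρ ∧ ρ ≤ t + e q J' := by
      refine hup.imp_right fun ⟨h1, ρ, h2, h3, h4⟩ => ⟨h1, ρ, h2, h3, ?_⟩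
      linarith [(he q J').1]
    rcases le_or_gt J'.1 J.1 with hle | hlt
    · have hnG : J' ∉ G := fun hmem => by
        have := h.mem_completed J' hmem
        rw [hx] at this
        exact hJ'.1.2 this
      refine ⟨insert J' G, w, ⟨?_, ?_, ?_, ?_, ?_, ?_, ?_⟩⟩
      · intro J₁ hJ₁
        rcases Finset.mem_insert.1 hJ₁ with rfl | hJ₁
        · exact hle
        · exact h.task_le J₁ hJ₁
      · intro J₁ hJ₁
        rcases Finset.mem_insert.1 hJ₁ with rfl | hJ₁
        · exact hhigh _ _ _ rfl hJ' hle
        · exact h.le_release J₁ hJ₁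
      · intro J₁ hJ₁
        rcases Finset.mem_insert.1 hJ₁ with rfl | hJ₁
        · exact ⟨q, Nat.lt_succ_self q, by rw [hx]; exact hJ'.1.1⟩
        · exact hrelG J₁ hJ₁
      · intro J₁ hJ₁
        rw [hy]
        rcases Finset.mem_insert.1 hJ₁ with rfl | hJ₁
        · exact Set.mem_insert _ _
        · exact hsub (by have := h.mem_completed J₁ hJ₁; rwa [hx] at this)
      · intro J₁ hJ₁ hJJ
        rcases Finset.mem_insert.1 hJ₁ with rfl | hJ₁
        · by_contra! hge
          have hlt : J.2 < J₁.2 := lt_of_le_of_ne hge fun heq =>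
            hnJ (Prod.ext hJJ heq.symm)
          have h1 := τ.release_lt_release J.1 hlt
          have h2 : τ.release J ≤ t := by
            have h3 : τ.release (J.1, J₁.2) = τ.release J₁ := by rw [← hJJ]
            have h4 := hJ'.1.1
            rw [← h3] at h4
            exact h1.le.trans h4
          rcases hJ'.2 J ⟨h2, hJq⟩ with h3 | h3
          · exact absurd h3 (by rw [hJJ]; exact lt_irrefl _)
          · omega
        · exact h.index_lt J₁ hJ₁ hJJ
      · rw [Finset.sum_insert hnG, if_neg hne, hy]
        simp only [PlatformState.time] at htime ⊢
        linarith
      · exact Or.inl ⟨_, _, hy, hup'⟩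
    · have hqp := hlow _ _ _ rfl hJ' hlt
      have h1 := τ.C_le_blocking hlt
      refine ⟨G, w, keep w ?_ (Or.inl ⟨_, _, rfl, hup'⟩)⟩
      have h2 : (σ p).time = t := by rw [← hqp, hx]; rfl
      rw [h2]
      simp only [PlatformState.time]
      linarith
  | @interrupt t ρ d J' hJ' hr =>
    have hCe := (he q J').2
    have hρ := hr.1.1.1
    have hle' := hr.2
    rcases hmode with ⟨t', d', h1, h2⟩ | ⟨t', d', h1, h2⟩
    · cases h1
      rcases h2 with rfl | ⟨-, ρ₁, h3, h4, h5⟩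
      -- The coming reboot keeps its share `Cr`; the rest of the overhead covers the discarded
      -- execution. If the victim has lower priority, its time is charged to the blocking instead.
      · refine ⟨G, τ.overhead J.1 - τ.Cr, keep _ ?_ (Or.inr ⟨_, _, rfl, by ring⟩)⟩
        rcases le_or_gt J'.1 J.1 with hle | hlt
        · have := τ.add_C_le_overhead (hcrit ρ hρ) hle
          simp only [PlatformState.time] at htime ⊢
          linarith
        · have hqp := hlow _ _ _ rfl hJ' hlt
          have h1 := τ.C_le_blocking hlt
          have h2 : (σ p).time = t := by rw [← hqp, hx]; rfl
          have h3 := τ.add_C_le_overhead (hcrit ρ hρ) le_rfl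
          have h4 := τ.C_pos J.1
          rw [h2]
          simp only [PlatformState.time]
          linarith
      -- Both restarts would lie in an interval of length `L` beginning at step `p`, against the
      -- separation.
      · exfalso
        have h6 := hsep ρ₁ h3 ρ hρ (h5.trans_lt hr.1.1.2)
        have h7 := hbound _ _ _ rfl hJ'
        linarith
    · cases h1
  | idle hnp hn hr => exact absurd (hidle _ _ _ rfl hnp hn rfl) (lt_irrefl _)
  | idleRestart hnp hn hr => exact absurd (hidle _ _ _ rfl hnp hn rfl) (not_lt.2 hr.2)
  | @reboot t d hr =>
    rcases hmode with ⟨t', d', h1, h2⟩ | ⟨t', d', h1, h2⟩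
    · cases h1
    · cases h1
      refine ⟨G, τ.overhead J.1, keep _ ?_
        (Or.inl ⟨_, _, rfl, Or.inr ⟨rfl, t, hdown rfl, hpq', ?_⟩⟩)⟩
      · simp only [PlatformState.time] at htime ⊢
        linarith
      · linarith [τ.Cr_nonneg]
  | @rebootAgain t ρ d hr =>
    exfalso
    have h1 := hsep t (hdown rfl) ρ hr.1.1.1 hr.1.1.2
    have h2 := hL.sum_C_le (G := ∅) (a := 0) (by simp)
    rw [Finset.sum_empty] at h2
    have h3 := τ.add_C_le_overhead (hcrit ρ hr.1.1.1) le_rfl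
    have h4 := τ.C_pos J.1
    have h5 := hr.2
    linarith

/-- Every step of a busy period has an account, and the busy period is shorter than the active
period. -/
lemma IsBusyStart.exists_account {J : Job n} {p : ℕ} {L : ℝ} (hp : τ.IsBusyStart σ J p)
    (hσ : τ.IsSchedule Rs e σ) (he : τ.ValidExec e) (hcrit : ∀ ρ ∈ Rs, τ.IsCritical J.1)
    (hsep : ∀ ρ ∈ Rs, ∀ ρ' ∈ Rs, ρ < ρ' → L < ρ' - ρ) (hL : τ.IsActivePeriod J.1 L)
    {q : ℕ} (hpq : p ≤ q) (hJ : J ∉ (σ q).completed) :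
    (σ q).time < (σ p).time + L ∧ ∃ G w, τ.Account Rs σ J p q G w := by
  induction q, hpq using Nat.le_induction with
  | base =>
    refine ⟨by linarith [hL.1.1], ?_⟩
    cases hx : σ p with
    | up t d =>
      refine ⟨∅, 0, by simp, by simp, by simp, by simp, by simp, by simp, ?_⟩
      exact Or.inl ⟨t, d, hx, Or.inl rfl⟩
    | down t d =>
      have := τ.add_C_le_overhead (hcrit t (hσ.time_mem_of_down hx)) le_rfl
      have := τ.C_pos J.1
      -- A busy period may begin at a restart; the share for discarded work is then granted although
      -- nothing was lost.
      refine ⟨∅, τ.overhead J.1 - τ.Cr, by simp, by simp, by simp, by simp, by simp, ?_, ?_⟩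
      · simp only [sub_self, if_true, Finset.sum_empty]
        linarith
      · exact Or.inr ⟨t, d, hx, by ring⟩
  | succ q hpq ih =>
    obtain ⟨hq, G, w, h⟩ := ih fun hmem => hJ ((hσ.2 q).completed_subset hmem)
    obtain ⟨G', w', h'⟩ := h.exists_succ hσ he hcrit hsep hL hp hpq hq hJ
    exact ⟨h'.time_lt hσ he hcrit hL hp hpq hq hJ, G', w', h'⟩

/-- If restarts are further apart than the active period of task `i`, and there are none in case
that `i` is not critical, then the jobs of `i` meet their deadlines. -/
lemma IsSchedule.meetsDeadline (hσ : τ.IsSchedule Rs e σ) (he : τ.ValidExec e)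
    (hTr : 0 < τ.Tr) (hRs : τ.ValidRestarts Rs) {J : Job n} {L : ℝ} {S : ℕ → ℝ}
    (hcrit : ∀ ρ ∈ Rs, τ.IsCritical J.1)
    (hsep : ∀ ρ ∈ Rs, ∀ ρ' ∈ Rs, ρ < ρ' → L < ρ' - ρ) (hL : τ.IsActivePeriod J.1 L)
    (hS : ∀ k ∈ Finset.Icc 1 ⌈L / τ.T J.1⌉₊, τ.IsStartTime J.1 k (S k) ∧
      S k + τ.C J.1 ≤ ((k : ℝ) - 1) * τ.T J.1 + τ.D J.1) : τ.MeetsDeadline σ J := by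
  classical
  obtain ⟨p, hp⟩ := hσ.exists_isBusyStart he hTr hRs J
  have hmono := hσ.time_mono he
  have hacc := fun q => @IsBusyStart.exists_account n τ Rs e σ J p L hp hσ he hcrit hsep hL q
  have hTi := τ.T_pos J.1
  have hex : ∃ q, J ∈ (σ q).completed := by
    by_contra! hno
    obtain ⟨s, hs⟩ := hσ.exists_time_gt he hTr hRs ((σ p).time + L)
    have h1 : (σ s).time ≤ (σ (max s p)).time := hmono (le_max_left s p)
    have h2 := (hacc (max s p) (le_max_right s p) (hno _)).1
    linarith
  obtain ⟨q, hq, hq1, hpq⟩ : ∃ q, J ∉ (σ q).completed ∧ J ∈ (σ (q + 1)).completed ∧ p ≤ q := by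
    have h1 := Nat.find_spec hex
    have h2 : p < Nat.find hex := by
      by_contra! hle
      exact hp.2.2.1 (hσ.completed_mono hle h1)
    obtain ⟨q, hq⟩ : ∃ q, Nat.find hex = q + 1 := ⟨Nat.find hex - 1, by omega⟩
    exact ⟨q, Nat.find_min hex (by omega), hq ▸ h1, by omega⟩
  obtain ⟨t, d, hup, hrel, hup'⟩ : ∃ t d, σ q = .up t d ∧ τ.release J ≤ t ∧
      σ (q + 1) = .up (t + e q J) (insert J d) := by
    have hstep := hσ.2 q
    generalize σ q = x at *
    generalize σ (q + 1) = y at *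
    cases hstep with
    | @finish t d J' hJ' hr =>
      rcases hq1 with rfl | hmem
      · exact ⟨t, d, rfl, hJ'.1.1, rfl⟩
      · exact absurd hmem hq
    | _ => exact absurd hq1 hq
  have htq : (σ q).time = t := by rw [hup]; rfl
  set a := (σ p).time with ha
  have htL := (hacc q hpq hq).1
  -- `⌈u⌉` bounds from below the index of every job of this task released at or after `a`. Counting
  -- from it makes `J` number `k`.
  set u := (a - τ.φ J.1) / τ.T J.1
  have hu : ⌈u⌉ ≤ (J.2 : ℤ) := ceil_le_index hp.2.1
  obtain ⟨k, hk⟩ : ∃ k : ℕ, (k : ℤ) = J.2 - ⌈u⌉ + 1 := ⟨(J.2 - ⌈u⌉ + 1).toNat, by omega⟩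
  have hkR : (k : ℝ) - 1 = J.2 - ⌈u⌉ := by
    have : (k : ℝ) = J.2 - ⌈u⌉ + 1 := by exact_mod_cast hk
    linarith
  have hkT : a + ((k : ℝ) - 1) * τ.T J.1 ≤ τ.release J := by
    have h1 := Int.le_ceil u
    rw [div_le_iff₀ hTi] at h1
    rw [hkR]
    simp only [release]
    linarith
  have hkK : k ∈ Finset.Icc 1 ⌈L / τ.T J.1⌉₊ := by
    rw [Finset.mem_Icc]
    refine ⟨by omega, ?_⟩
    have h1 : (k : ℝ) - 1 < L / τ.T J.1 := by
      rw [lt_div_iff₀ hTi]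
      linarith
    have h2 : (k : ℝ) < ⌈L / τ.T J.1⌉₊ + 1 := by
      have := Nat.le_ceil (L / τ.T J.1)
      linarith
    have h3 : k < ⌈L / τ.T J.1⌉₊ + 1 := by exact_mod_cast h2
    omega
  obtain ⟨⟨⟨hS0, hSeq⟩, -⟩, hSd⟩ := hS k hkK
  -- Jobs completed by step `q + 1` were released by the time of an earlier step, hence by `a + S
  -- k`. Their work is thus bounded by the right side of the equation for `S k`, with at most `k -
  -- 1` jobs of the task of `J`. Minimality of `S k` plays no role.
  have hstart : ∀ q, p ≤ q → J ∉ (σ q).completed → (σ q).time ≤ a + S k := by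
    intro q hpq
    induction q, hpq using Nat.le_induction with
    | base => exact fun _ => by linarith
    | succ q hpq ih =>
      intro hJ
      have hq := ih fun hmem => hJ ((hσ.2 q).completed_subset hmem)
      obtain ⟨-, G, w, h⟩ := hacc (q + 1) (by omega) hJ
      have hrelG : ∀ J' ∈ G, a ≤ τ.release J' ∧ τ.release J' ≤ a + S k := by
        intro J' hJ'
        obtain ⟨q', hq', hrel⟩ := h.release_le J' hJ'
        have : (σ q').time ≤ (σ q).time := hmono (Nat.lt_succ_iff.1 hq')
        exact ⟨h.le_release J' hJ', by linarith⟩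
      have hsum := τ.sum_C_le (G := G) (A := Finset.Iic J.1)
        (N := fun j => if j = J.1 then (k : ℝ) - 1 else (⌊S k / τ.T j⌋ : ℝ) + 1)
        (fun J' hJ' => Finset.mem_Iic.2 (h.task_le J' hJ')) (by
          intro j _
          split_ifs with hj
          · subst hj
            rw [hkR]
            have := card_filter_task_le (G := G) (j := J.1) (lo := ⌈u⌉) (hi := J.2)
              (N := J.2 - ⌈u⌉) (by
                intro J' hJ' hJJ
                refine ⟨?_, by exact_mod_cast h.index_lt J' hJ' hJJ⟩
                have := ceil_le_index (hrelG J' hJ').1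
                rwa [hJJ] at this) le_rfl (by omega)
            exact_mod_cast this
          · exact card_filter_task_le_floor hS0 fun J' hJ' _ => hrelG J' hJ')
      have hcongr : ∑ j ∈ Finset.Iio J.1,
          (if j = J.1 then (k : ℝ) - 1 else (⌊S k / τ.T j⌋ : ℝ) + 1) * τ.C j =
            ∑ j ∈ Finset.Iio J.1, ((⌊S k / τ.T j⌋ : ℝ) + 1) * τ.C j :=
        Finset.sum_congr rfl fun j hj => by rw [if_neg (Finset.mem_Iio.1 hj).ne]
      rw [sum_Iic_eq, if_pos rfl, hcongr] at hsum
      have := h.time_le' hσ hcrit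
      linarith
  refine ⟨q + 1, _, _, hup', Set.mem_insert _ _, ?_⟩
  have h1 := hstart q hpq hq
  have h2 := (he q J).2
  simp only [deadline]
  linarith

end Busy

end TaskSystem

end RestartRecovery

theorem mainTheorem2 {n : ℕ} (τ : RestartRecovery.TaskSystem n)
    (hTr : τ.HyperperiodLtTr)
    (R : Fin n → ℝ) (hR : ∀ i, τ.IsResponseTime i (R i))
    (hRD : ∀ i, R i ≤ τ.D i) :
    τ.RBRFeasible := by
  have hb : ∀ i, τ.ResponseBounded i := fun i => (hR i).responseBounded (hRD i)
  obtain ⟨H, hH, hHm, hHT⟩ := hTr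
  have hTr0 : 0 < τ.Tr := hH.trans hHT
  refine ⟨fun Rs hRs e he => ⟨τ.exists_isSchedule hTr0 hRs e, fun σ hσ J hJ => ?_⟩,
    fun e he => ?_⟩
  · obtain ⟨L, S, hL, hS⟩ := hb J.1
    -- Tasks of priority above a critical one are critical, so `H` is a multiple of all periods
    -- involved.
    have hLH : L ≤ H := hL.le_hyperperiod hb hH fun j hj =>
      hHm j (lt_of_le_of_lt (Fin.le_def.1 hj) hJ)
    refine hσ.meetsDeadline he hTr0 hRs (fun _ _ => hJ) (fun ρ hρ ρ' hρ' hlt => ?_) hL hS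
    have := hRs.2 ρ hρ ρ' hρ' hlt
    linarith
  · have hRs : τ.ValidRestarts ∅ := ⟨by simp, by simp⟩
    refine ⟨τ.exists_isSchedule hTr0 hRs e, fun σ hσ J _ => ?_⟩
    obtain ⟨L, S, hL, hS⟩ := hb J.1
    exact hσ.meetsDeadline he hTr0 hRs (by simp) (by simp) hL hS
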